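/- Let $h$ be the morphism on binary words with $h(1)=110$ and $h(0)=11$. For $n\ge 0$ let $K_n=h^n(1)$ and let $\mathcal K_n=|K_n|$ be its length (so $\mathcal K_0=1$, $\mathcal K_1=3$, $\mathcal K_2=8$). Each $K_n$ is a prefix of $K_{n+1}$; let $\mathbf k=1101101111\cdots$ be the unique infinite word having every $K_n$ as a prefix. A finite binary word $w$ is called a right-special factor of $\mathbf k$ if both $w0$ and $w1$ occur in $\mathbf k$. Then for every $n\ge 0$ the word $\mathbf k$ has at most two distinct right-special factors of length $n$. Moreover, $\mathbf k$ has exactly two distinct right-special factors of length $n$ if and only if there exists $i\ge 0$ such that one of the following holds: - $x\le n<x+\mathcal K_{2i}$, where $x=\mathcal K_1+\mathcal K_3+\cdots+\mathcal K_{2i+1}$; - $y\le n<y+\mathcal K_{2i+1}$, where $y=\mathcal K_0+\mathcal K_2+\cdots+\mathcal K_{2i+2}$. -/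

import Mathlib

namespace Kimberling

/-- The morphism `h` on letters: `h(0) = 11`, `h(1) = 110`. -/
def h (a : Fin 2) : List (Fin 2) := if a = 0 then [1, 1] else [1, 1, 0]

/-- `h` extended to finite words by concatenation. -/
def hWord (w : List (Fin 2)) : List (Fin 2) := w.flatMap h

/-- The finite word `K_n = h^n(1)`. -/
def K (n : ℕ) : List (Fin 2) := hWord^[n] [1]

/-- The length `𝒦_n = |K_n|`. -/
def calK (n : ℕ) : ℕ := (K n).length

/-- The infinite word `k = k_1 k_2 k_3 ⋯`, the limit of the words `K_n`. It is indexed here from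
`0`, so `k m` is the letter `k_{m+1}`; by `lt_calK` the default value of `getD` is never used,
and by `K_eq` and `eq_k` it is the unique infinite word having every `K_n` as a prefix. -/
def k (m : ℕ) : Fin 2 := (K m).getD m 0

/-- The finite word `w` is a factor of the infinite word `x`: it occurs at some position `i`. -/
def IsFactor (x : ℕ → Fin 2) (w : List (Fin 2)) : Prop :=
  ∃ i : ℕ, ∀ (t : ℕ) (ht : t < w.length), w[t] = x (i + t)

/-- `w` is right-special in the binary word `x`: both `w0` and `w1` appear in `x`. -/
def IsRightSpecial (x : ℕ → Fin 2) (w : List (Fin 2)) : Prop :=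
  IsFactor x (w ++ [0]) ∧ IsFactor x (w ++ [1])

/-- The set of (distinct) right-special factors of `x` of length `n`. -/
def rightSpecial (x : ℕ → Fin 2) (n : ℕ) : Set (List (Fin 2)) :=
  {w | w.length = n ∧ IsRightSpecial x w}

theorem K_succ (n : ℕ) : K (n + 1) = hWord (K n) := by
  simp only [K, Function.iterate_succ_apply']

theorem K_prefix_succ (n : ℕ) : K n <+: K (n + 1) := by
  induction n with
  | zero => exact ⟨[1, 0], rfl⟩
  | succ n ih =>
    obtain ⟨t, ht⟩ := ih
    refine ⟨hWord t, ?_⟩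
    rw [K_succ (n + 1), ← ht]
    have e : hWord (K n) = K n ++ t := by rw [ht, K_succ]
    simp only [hWord, List.flatMap_append] at e ⊢
    rw [e]

theorem K_prefix {m n : ℕ} (hmn : m ≤ n) : K m <+: K n := by
  induction hmn with
  | refl => exact List.prefix_refl _
  | step _ ih => exact ih.trans (K_prefix_succ _)

theorem length_hWord (w : List (Fin 2)) : 2 * w.length ≤ (hWord w).length := by
  induction w with
  | nil => simp
  | cons a w ih =>
    have ha : 2 ≤ (h a).length := by revert a; decide
    simp only [hWord, List.flatMap_cons, List.length_append, List.length_cons] at ih ⊢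
    omega

theorem lt_calK (n : ℕ) : n < calK n := by
  induction n with
  | zero => decide
  | succ n ih =>
    have := length_hWord (K n)
    unfold calK at ih ⊢
    rw [K_succ]
    omega

/-- Every `K_n` is a prefix of `k`. -/
theorem K_eq (n m : ℕ) (hm : m < (K n).length) : (K n)[m] = k m := by
  have hm' : m < (K m).length := lt_calK m
  have hk : k m = (K m)[m] := by simp [k, hm']
  rw [hk]
  rcases le_total m n with hmn | hmn
  · exact ((K_prefix hmn).getElem hm').symm
  · exact (K_prefix hmn).getElem hm

/-- `k` is the only infinite word having every `K_n` as a prefix. -/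
theorem eq_k (x : ℕ → Fin 2) (hx : ∀ (n m : ℕ) (hm : m < (K n).length), (K n)[m] = x m) :
    x = k := by
  funext m
  have hm : m < (K m).length := lt_calK m
  exact (hx m m hm).symm.trans (K_eq m m hm)

end Kimberling

namespace Kimberling

/-! Suffixes of right-special factors are right-special, so these factors form a tree under left
extension, and counting them by length means locating its branchings and dead ends. The map `lift`,
u ↦ h(u)11, preserves right-speciality. Conversely, every right-special word containing 0 is a
suffix of some `lift v` with `v` right-special (`IsRightSpecial.exists_lift`). Since `h a` ends in
`1 - a`, left extensions of `u` and of `lift u` correspond with the added letter flipped.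

Hence the branchings are the iterated lifts of 11, the dead ends those of 111, and every other node
has exactly one child (`existsUnique_cons_isRightSpecial`). Lengths interlace, |`branch i`| < |`leaf
i`| < |`branch (i + 1)`|, so there are two factors of length n exactly when |`branch i`| < n ≤
|`leaf i`| for some i. The recurrence for `calK` turns these bounds into the stated sums. -/

/-! ### Decoding images under `h` -/

theorem hWord_append (u v : List (Fin 2)) : hWord (u ++ v) = hWord u ++ hWord v := by
  simp [hWord]

theorem hWord_cons (a : Fin 2) (v : List (Fin 2)) : hWord (a :: v) = h a ++ hWord v := by
  simp [hWord]

theorem hWord_nil : hWord [] = [] := rfl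

theorem h_zero : h 0 = [1, 1] := rfl

theorem h_one : h 1 = [1, 1, 0] := rfl

theorem hWord_infix {u v : List (Fin 2)} (huv : u <:+: v) : hWord u <:+: hWord v := by
  obtain ⟨s, t, rfl⟩ := huv
  exact ⟨hWord s, hWord t, by simp [hWord_append]⟩

theorem hWord_suffix {u v : List (Fin 2)} (huv : u <:+ v) : hWord u <:+ hWord v := by
  obtain ⟨s, rfl⟩ := huv
  exact ⟨hWord s, by simp [hWord_append]⟩

/-- Every `0` in an image under `h` is the last letter of a block `h 1`. -/
theorem hWord_split_zero {x p q : List (Fin 2)} (hx : hWord x = p ++ 0 :: q) :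
    ∃ x₁ x₂, x = x₁ ++ 1 :: x₂ ∧ p = hWord x₁ ++ [1, 1] ∧ q = hWord x₂ := by
  induction x generalizing p with
  | nil => simp [hWord_nil] at hx
  | cons a x ih =>
    rw [hWord_cons] at hx
    have key : ∀ p', hWord x = p' ++ 0 :: q → p = h a ++ p' →
        ∃ x₁ x₂, a :: x = x₁ ++ 1 :: x₂ ∧ p = hWord x₁ ++ [1, 1] ∧ q = hWord x₂ := by
      intro p' h1 h2
      obtain ⟨x₁, x₂, rfl, rfl, rfl⟩ := ih h1
      exact ⟨a :: x₁, x₂, rfl, by simp [h2, hWord_cons], rfl⟩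
    match a, p, hx with
    | 0, [], hx => simp [h_zero] at hx
    | 0, [_], hx => simp [h_zero] at hx
    | 0, b :: c :: p', hx =>
      simp only [h_zero, List.cons_append, List.nil_append, List.cons.injEq] at hx
      obtain ⟨rfl, rfl, hx⟩ := hx
      exact key p' hx rfl
    | 1, [], hx => simp [h_one] at hx
    | 1, [_], hx => simp [h_one] at hx
    | 1, [b, c], hx =>
      simp only [h_one, List.cons_append, List.nil_append, List.cons.injEq, true_and] at hx
      obtain ⟨rfl, rfl, rfl⟩ := hx
      exact ⟨[], x, rfl, rfl, rfl⟩
    | 1, b :: c :: d :: p', hx =>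
      simp only [h_one, List.cons_append, List.nil_append, List.cons.injEq] at hx
      obtain ⟨rfl, rfl, rfl, hx⟩ := hx
      exact key p' hx rfl

/-- `h 0` is a prefix of `h 1`, so decoding from the left needs one letter of lookahead: 11 followed
by 1 must be `h 0`. -/
theorem prefix_of_hWord_prefix {u x : List (Fin 2)} (hu : hWord u ++ [1, 1, 1] <+: hWord x) :
    u ++ [0] <+: x := by
  induction u generalizing x with
  | nil =>
    match x, hu with
    | [], hu => simp [hWord_nil] at hu
    | 0 :: x, _ => simp
    | 1 :: x, hu => simp [hWord_nil, hWord_cons, h_one] at hu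
  | cons a u ih =>
    have head : ∃ t, hWord u ++ [1, 1, 1] = 1 :: t := by
      match u with
      | [] => exact ⟨_, rfl⟩
      | 0 :: u => exact ⟨_, rfl⟩
      | 1 :: u => exact ⟨_, rfl⟩
    match a, x, hu with
    | 0, [], hu => simp [hWord_nil, hWord_cons, h_zero] at hu
    | 1, [], hu => simp [hWord_nil, hWord_cons, h_one] at hu
    | 0, 0 :: x, hu =>
      rw [hWord_cons, hWord_cons, List.append_assoc, List.prefix_append_right_inj] at hu
      simpa using ih hu
    | 1, 1 :: x, hu =>
      rw [hWord_cons, hWord_cons, List.append_assoc, List.prefix_append_right_inj] at hu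
      simpa using ih hu
    | 0, 1 :: x, hu =>
      obtain ⟨t, ht⟩ := head
      rw [hWord_cons, hWord_cons, List.append_assoc, ht] at hu
      simp [h_zero, h_one] at hu
    | 1, 0 :: x, hu =>
      rw [hWord_cons, hWord_cons] at hu
      match x, hu with
      | [], hu => simp [h_zero, h_one, hWord_nil] at hu
      | 0 :: x, hu => simp [h_zero, h_one, hWord_cons] at hu
      | 1 :: x, hu => simp [h_zero, h_one, hWord_cons] at hu

theorem hWord_concat (u : List (Fin 2)) (a : Fin 2) : hWord (u ++ [a]) = hWord u ++ h a := by
  simp [hWord]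

/-- The last letter of a block determines the block, so decoding from the right is deterministic. -/
theorem eq_of_last_mem {w x y : List (Fin 2)} {a b : Fin 2} (hw : w ≠ [])
    (h1 : w <:+ x ++ h a) (h2 : w <:+ y ++ h b) : a = b := by
  obtain ⟨w, c, rfl⟩ := List.eq_nil_or_concat' w |>.resolve_left hw
  have last : ∀ (z : List (Fin 2)) (d : Fin 2), w ++ [c] <:+ z ++ h d → c = 1 - d := by
    intro z d hd
    obtain ⟨t, ht⟩ := hd
    have := congrArg List.getLast? ht
    match d, this with
    | 0, this => simpa [h_zero] using this
    | 1, this => simpa [h_one] using this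
  have e := (last _ _ h1).symm.trans (last _ _ h2)
  have inj : ∀ a b : Fin 2, 1 - a = 1 - b → a = b := by decide
  exact inj a b e

theorem h_ne_nil (a : Fin 2) : h a ≠ [] := by revert a; decide

theorem suffix_of_hWord_suffix {u z : List (Fin 2)} (hu : hWord u <:+ hWord z) : u <:+ z := by
  induction u using List.reverseRecOn generalizing z with
  | nil => simp
  | append_singleton u a ih =>
    rcases List.eq_nil_or_concat' z with rfl | ⟨z, b, rfl⟩
    · simp [hWord_concat, hWord_nil, h_ne_nil] at hu
    · rw [hWord_concat, hWord_concat] at hu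
      obtain rfl : a = b := eq_of_last_mem (by simp [h_ne_nil]) (List.suffix_refl _) hu
      rw [List.suffix_append_self_iff] at hu
      rw [List.suffix_append_self_iff]
      exact ih hu

/-- A suffix of an image under `h` has a shortest preimage. -/
theorem exists_minimal_preimage {w z : List (Fin 2)} (hw : w <:+ hWord z) :
    ∃ v, w <:+ hWord v ∧ ∀ z', w <:+ hWord z' → v <:+ z' := by
  induction z using List.reverseRecOn generalizing w with
  | nil =>
    exact ⟨[], hw, fun z' _ => List.nil_suffix⟩
  | append_singleton z a ih =>
    by_cases hnil : w = []
    · subst hnil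
      exact ⟨[], List.nil_suffix, fun z' _ => List.nil_suffix⟩
    rw [hWord_concat] at hw
    have last : ∀ z', w <:+ hWord z' → ∃ y, z' = y ++ [a] := by
      intro z' hz'
      rcases List.eq_nil_or_concat' z' with rfl | ⟨y, b, rfl⟩
      · simp [hWord_nil, hnil] at hz'
      · rw [hWord_concat] at hz'
        exact ⟨y, by rw [eq_of_last_mem hnil hw hz']⟩
    rcases List.suffix_or_suffix_of_suffix hw (List.suffix_append (hWord z) (h a)) with hs | hs
    · refine ⟨[a], by simpa [hWord_cons, hWord_nil] using hs, fun z' hz' => ?_⟩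
      obtain ⟨y, rfl⟩ := last z' hz'
      exact List.suffix_append _ _
    · obtain ⟨w, rfl⟩ := hs
      rw [List.suffix_append_self_iff] at hw
      obtain ⟨v, hv, hmin⟩ := ih hw
      refine ⟨v ++ [a], by rwa [hWord_concat, List.suffix_append_self_iff], fun z' hz' => ?_⟩
      obtain ⟨y, rfl⟩ := last z' hz'
      rw [hWord_concat, List.suffix_append_self_iff] at hz'
      rw [List.suffix_append_self_iff]
      exact hmin y hz'

/-! ### Factors of `k` and their preimages -/

theorem isFactor_k_iff {w : List (Fin 2)} : IsFactor k w ↔ ∃ n, w <:+: K n := by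
  constructor
  · rintro ⟨i, hi⟩
    have hlen : i + w.length < (K (i + w.length)).length := lt_calK _
    generalize hN : i + w.length = N at hlen
    refine ⟨N, ?_⟩
    have : w = ((K N).drop i).take w.length := by
      apply List.ext_getElem
      · simp; omega
      · intro t h1 h2
        simp only [List.getElem_take, List.getElem_drop]
        rw [K_eq, hi t h1]
    exact this ▸ (List.take_prefix _ _).isInfix.trans (List.drop_suffix _ _).isInfix
  · rintro ⟨n, s, t, hst⟩
    refine ⟨s.length, fun j hj => ?_⟩
    have hlen := congrArg List.length hst
    simp only [List.length_append] at hlen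
    rw [← K_eq n (s.length + j) (by omega)]
    simp only [← hst]
    rw [List.getElem_append_left (by simp; omega), List.getElem_append_right (by omega)]
    simp

theorem IsFactor.infix {v w : List (Fin 2)} (hw : IsFactor k w) (hv : v <:+: w) :
    IsFactor k v := by
  rw [isFactor_k_iff] at *
  obtain ⟨n, hn⟩ := hw
  exact ⟨n, hv.trans hn⟩

theorem IsFactor.hWord {w : List (Fin 2)} (hw : IsFactor k w) : IsFactor k (hWord w) := by
  rw [isFactor_k_iff] at *
  obtain ⟨n, hn⟩ := hw
  exact ⟨n + 1, by rw [K_succ]; exact hWord_infix hn⟩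

theorem IsFactor.exists_append {x : ℕ → Fin 2} {w : List (Fin 2)} (hw : IsFactor x w) :
    ∃ a, IsFactor x (w ++ [a]) := by
  obtain ⟨i, hi⟩ := hw
  refine ⟨x (i + w.length), i, fun t ht => ?_⟩
  rw [List.getElem_append]
  split_ifs with h1
  · exact hi t h1
  · simp only [List.length_append, List.length_singleton] at ht
    obtain rfl : t = w.length := by omega
    simp

theorem IsFactor.exists_hWord {w : List (Fin 2)} (hw : IsFactor k w) :
    ∃ x p q, IsFactor k x ∧ Kimberling.hWord x = p ++ w ++ q := by
  obtain ⟨n, hn⟩ := isFactor_k_iff.1 hw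
  obtain ⟨p, q, e⟩ := hn.trans (K_prefix_succ n).isInfix
  exact ⟨K n, p, q, isFactor_k_iff.2 ⟨n, List.infix_refl _⟩, by rw [e, K_succ]⟩

theorem exists_suffix_of_isFactor_zero {w : List (Fin 2)} (hw : IsFactor k (w ++ [0])) :
    ∃ y, IsFactor k (y ++ [1]) ∧ w <:+ hWord y ++ [1, 1] := by
  obtain ⟨x, p, q, hx, e⟩ := hw.exists_hWord
  obtain ⟨y, y', rfl, e', -⟩ := hWord_split_zero (p := p ++ w) (q := q) (by simpa using e)
  exact ⟨y, hx.infix ⟨[], y', by simp⟩, p, e'⟩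

/-! ### Right-special factors under `lift` -/

theorem IsRightSpecial.suffix {v w : List (Fin 2)} (hw : IsRightSpecial k w) (hv : v <:+ w) :
    IsRightSpecial k v := by
  obtain ⟨s, rfl⟩ := hv
  exact ⟨hw.1.infix ⟨s, [], by simp⟩, hw.2.infix ⟨s, [], by simp⟩⟩

/-- The map `u ↦ h(u)11`, which carries right-special factors to right-special factors. -/
def lift (u : List (Fin 2)) : List (Fin 2) := hWord u ++ [1, 1]

theorem lift_append (u v : List (Fin 2)) : lift (u ++ v) = hWord u ++ lift v := by
  simp [lift, hWord_append]

theorem lift_suffix {u v : List (Fin 2)} (huv : u <:+ v) : lift u <:+ lift v := by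
  rw [lift, lift, List.suffix_append_self_iff]
  exact hWord_suffix huv

theorem suffix_of_lift_suffix {u v : List (Fin 2)} (huv : lift u <:+ lift v) : u <:+ v := by
  rw [lift, lift, List.suffix_append_self_iff] at huv
  exact suffix_of_hWord_suffix huv

theorem length_lt_length_lift (u : List (Fin 2)) : u.length < (lift u).length := by
  have := length_hWord u
  simp only [lift, List.length_append, List.length_cons, List.length_nil]
  omega

/-- From u1 comes h(u)110. From u0 comes h(u)11 followed by the next block, which begins with 1. -/
theorem IsRightSpecial.lift {u : List (Fin 2)} (hu : IsRightSpecial k u) :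
    IsRightSpecial k (lift u) := by
  constructor
  · have := hu.2.hWord
    simpa [hWord_concat, h_one, Kimberling.lift] using this
  · obtain ⟨a, ha⟩ := hu.1.exists_append
    refine ha.hWord.infix (List.IsPrefix.isInfix ?_)
    match a with
    | 0 => simp [hWord_append, hWord_cons, hWord_nil, h_zero, Kimberling.lift]
    | 1 => simp [hWord_append, hWord_cons, hWord_nil, h_zero, h_one, Kimberling.lift]

/-- Desubstitution: a right-special factor containing `0` is a suffix of `h(v)11` for a
right-special `v`, which can be taken to be the shortest word with that property. -/
theorem IsRightSpecial.exists_lift {w : List (Fin 2)} (hw : IsRightSpecial k w)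
    (hmem : (0 : Fin 2) ∈ w) :
    ∃ v, IsRightSpecial k v ∧ w <:+ Kimberling.lift v ∧
      ∀ z, w <:+ Kimberling.lift z → v <:+ z := by
  obtain ⟨y, hy, hwy⟩ := exists_suffix_of_isFactor_zero hw.1
  obtain ⟨w₁, w₂, rfl⟩ := List.append_of_mem hmem
  obtain ⟨s, hs⟩ := hwy
  -- The chosen 0 in `w` ends a block `h 1`, so the part of `w` after it decodes uniquely as
  -- h(y₂)11.
  have hy' : ∃ y₁ y₂, y = y₁ ++ 1 :: y₂ ∧ s ++ w₁ = hWord y₁ ++ [1, 1] ∧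
      w₂ = hWord y₂ ++ [1, 1] := by
    rw [← List.append_assoc] at hs
    have e : hWord (y ++ [1]) = (s ++ w₁) ++ 0 :: (w₂ ++ [0]) := by
      have := congrArg (· ++ [0]) hs
      simp only [List.append_assoc, List.cons_append, List.nil_append] at this
      rw [hWord_concat, h_one]
      simp [this]
    obtain ⟨y₁, y₂, e1, e2, e3⟩ := hWord_split_zero e
    rcases List.eq_nil_or_concat' y₂ with rfl | ⟨y₂, b, rfl⟩
    · simp [hWord_nil] at e3
    · have e1' : y ++ [1] = (y₁ ++ 1 :: y₂) ++ [b] := by simp [e1]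
      obtain ⟨e4, e5⟩ := List.append_inj' e1' rfl
      obtain rfl : (1 : Fin 2) = b := by simpa using e5
      refine ⟨y₁, y₂, e4, e2, ?_⟩
      have : w₂ ++ [0] = (hWord y₂ ++ [1, 1]) ++ [0] := by
        rw [e3]
        simp [hWord_append, hWord_cons, hWord_nil, h_one]
      exact List.append_cancel_right this
  obtain ⟨y₁, y₂, rfl, hw₁, hw₂⟩ := hy'
  have hmin : ∃ v, w₁ ++ 0 :: w₂ <:+ Kimberling.lift v ∧
      ∀ z, w₁ ++ 0 :: w₂ <:+ Kimberling.lift z → v <:+ z := by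
    have e : w₁ ++ 0 :: w₂ = (w₁ ++ 0 :: hWord y₂) ++ [1, 1] := by simp [hw₂]
    rw [e] at hs ⊢
    simp only [Kimberling.lift, List.suffix_append_self_iff]
    apply exists_minimal_preimage
    rw [← List.append_assoc] at hs
    exact ⟨s, List.append_cancel_right hs⟩
  obtain ⟨v, hwv, hv⟩ := hmin
  refine ⟨v, ⟨?_, ?_⟩, hwv, hv⟩
  -- In an occurrence of w1 the same y₂ reappears, and the final 111 forces it to be followed by 0;
  -- minimality makes `v` a suffix of this preimage too.
  · obtain ⟨x, p, q, hx, e⟩ := hw.2.exists_hWord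
    obtain ⟨x₁, x₂, rfl, e1, e2⟩ :=
      hWord_split_zero (p := p ++ w₁) (q := w₂ ++ [1] ++ q) (by simpa using e)
    have h3 : y₂ ++ [0] <+: x₂ := by
      apply prefix_of_hWord_prefix
      rw [← e2, hw₂]
      exact ⟨q, by simp⟩
    have h4 : v <:+ x₁ ++ 1 :: y₂ := by
      apply hv
      refine ⟨p, ?_⟩
      rw [← List.append_assoc, e1, hw₂]
      simp [Kimberling.lift, hWord_append, hWord_cons, h_one]
    obtain ⟨t, ht⟩ := h4
    obtain ⟨r, rfl⟩ := h3
    refine hx.infix ⟨t, r, ?_⟩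
    rw [← List.append_assoc t, ht]
    simp
  · obtain ⟨t, ht⟩ := hv (y₁ ++ 1 :: y₂) ⟨s, hs⟩
    exact hy.infix ⟨t, [], by rw [← ht]; simp⟩

/-! ### Forbidden factors and short right-special factors -/

theorem not_isFactor_zero_zero : ¬ IsFactor k [0, 0] := by
  intro hf
  obtain ⟨y, -, t, e⟩ := exists_suffix_of_isFactor_zero (w := [0]) hf
  have := congrArg List.getLast? e
  simp at this

theorem not_isFactor_zero_one_zero : ¬ IsFactor k [0, 1, 0] := by
  intro hf
  obtain ⟨y, -, t, e⟩ := exists_suffix_of_isFactor_zero (w := [0, 1]) hf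
  have := congrArg List.reverse e
  simp at this

/-- Removing the 11 that precedes the last 0 would leave an image ending in 01, but blocks end in 11
or 10. -/
theorem not_isFactor_zero_ones_zero : ¬ IsFactor k [0, 1, 1, 1, 0] := by
  intro hf
  obtain ⟨y, -, hy⟩ := exists_suffix_of_isFactor_zero (w := [0, 1, 1, 1]) hf
  have hy' : [0, 1] <:+ hWord y := by
    rwa [show ([0, 1, 1, 1] : List (Fin 2)) = [0, 1] ++ [1, 1] from rfl,
      List.suffix_append_self_iff] at hy
  rcases List.eq_nil_or_concat' y with rfl | ⟨y, b, rfl⟩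
  · simp [hWord_nil] at hy'
  · obtain ⟨t, e⟩ := hy'
    rw [hWord_concat] at e
    have := congrArg List.reverse e
    match b, this with
    | 0, this => simp [h_zero] at this
    | 1, this => simp [h_one] at this

/-- A run of five 1s needs two adjacent blocks `h 0`. -/
theorem ones_not_infix_hWord {x : List (Fin 2)} (hx : ¬ [0, 0] <:+: x) :
    ¬ [1, 1, 1, 1, 1] <:+: hWord x := by
  induction x with
  | nil => simp [hWord_nil]
  | cons a x ih =>
    have ih' := ih fun hf => hx (hf.trans (List.suffix_cons a x).isInfix)
    match a, x, hx with
    | 0, [], _ => decide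
    | 0, 0 :: x, hx => exact absurd ⟨[], x, rfl⟩ hx
    | 0, 1 :: x, _ =>
      simp only [hWord_cons, h_zero, h_one, List.cons_append, List.nil_append,
        List.infix_cons_iff, List.cons_prefix_cons] at ih' ⊢
      simpa using ih'
    | 1, x, _ =>
      simp only [hWord_cons, h_one, List.cons_append, List.nil_append,
        List.infix_cons_iff, List.cons_prefix_cons]
      simpa using ih'

theorem not_isFactor_ones : ¬ IsFactor k [1, 1, 1, 1, 1] := by
  intro hf
  obtain ⟨x, p, q, hx, e⟩ := hf.exists_hWord
  exact ones_not_infix_hWord (fun h0 => not_isFactor_zero_zero (hx.infix h0)) ⟨p, q, e.symm⟩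

theorem isRightSpecial_ones : IsRightSpecial k [1, 1, 1] :=
  ⟨isFactor_k_iff.2 ⟨3, by decide⟩, isFactor_k_iff.2 ⟨3, by decide⟩⟩

theorem isRightSpecial_one_zero_one_one : IsRightSpecial k [1, 0, 1, 1] :=
  ⟨isFactor_k_iff.2 ⟨3, by decide⟩, isFactor_k_iff.2 ⟨3, by decide⟩⟩

theorem IsRightSpecial.zero_mem {w : List (Fin 2)} (hw : IsRightSpecial k w)
    (hlen : 4 ≤ w.length) : (0 : Fin 2) ∈ w := by
  by_contra hmem
  have e : w = List.replicate w.length 1 := by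
    refine List.eq_replicate_of_mem fun b hb => ?_
    match b, hb with
    | 0, hb => exact absurd hb hmem
    | 1, _ => rfl
  refine not_isFactor_ones
    (hw.2.infix (v := [1, 1, 1, 1, 1]) ⟨List.replicate (w.length - 4) 1, [], ?_⟩)
  conv_rhs => rw [e, show w.length = w.length - 4 + 4 by omega, List.replicate_add]
  simp

theorem not_isRightSpecial_cons_ones (a : Fin 2) : ¬ IsRightSpecial k [a, 1, 1, 1] := by
  match a with
  | 0 => exact fun hw => not_isFactor_zero_ones_zero hw.1
  | 1 => exact fun hw => not_isFactor_ones hw.2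

theorem isRightSpecial_of_length_lt_four {w : List (Fin 2)} (hw : IsRightSpecial k w)
    (hlen : w.length < 4) : w ∈ [[], [1], [1, 1], [0, 1, 1], [1, 1, 1]] := by
  have h00 := not_isFactor_zero_zero
  have h010 := not_isFactor_zero_one_zero
  have tail : ∀ {s u v : List (Fin 2)}, ¬ IsFactor k u → s ++ u = v ++ [0] →
      w = v → False := by
    rintro s u v hu e rfl
    exact hu (hw.1.infix ⟨s, [], by simpa using e⟩)
  have two : ∀ a : Fin 2, a = 0 ∨ a = 1 := by decide
  match w, hlen with
  | [], _ => simp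
  | [a], _ =>
    rcases two a with rfl | rfl
    · exact (tail (s := []) h00 rfl rfl).elim
    · simp
  | [a, b], _ =>
    rcases two b with rfl | rfl
    · exact (tail (s := [a]) h00 rfl rfl).elim
    rcases two a with rfl | rfl
    · exact (tail (s := []) h010 rfl rfl).elim
    · simp
  | [a, b, c], _ =>
    rcases two c with rfl | rfl
    · exact (tail (s := [a, b]) h00 rfl rfl).elim
    rcases two b with rfl | rfl
    · exact (tail (s := [a]) h010 rfl rfl).elim
    rcases two a with rfl | rfl <;> simp

/-! ### Branchings and dead ends of the tree -/

/-- The branching right-special factors. -/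
def branch (i : ℕ) : List (Fin 2) := lift^[i] [1, 1]

/-- The right-special factors that do not extend to the left. -/
def leaf (i : ℕ) : List (Fin 2) := lift^[i] [1, 1, 1]

theorem branch_succ (i : ℕ) : branch (i + 1) = lift (branch i) :=
  Function.iterate_succ_apply' _ _ _

theorem leaf_succ (i : ℕ) : leaf (i + 1) = lift (leaf i) :=
  Function.iterate_succ_apply' _ _ _

/-- The last letter of `h a` is `1 - a`. -/
theorem cons_lift_suffix (a : Fin 2) (u : List (Fin 2)) : (1 - a) :: lift u <:+ lift (a :: u) := by
  match a with
  | 0 => exact ⟨[1], by simp [lift, hWord_cons, h_zero]⟩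
  | 1 => exact ⟨[1, 1], by simp [lift, hWord_cons, h_one]⟩

theorem IsRightSpecial.cons_lift {a : Fin 2} {u : List (Fin 2)}
    (hu : IsRightSpecial k (a :: u)) : IsRightSpecial k ((1 - a) :: Kimberling.lift u) :=
  hu.lift.suffix (cons_lift_suffix a u)

/-- Any preimage of the longer word has `u` as a proper suffix, and the letter before that `u` is
forced by `a`. -/
theorem IsRightSpecial.of_cons_lift {a : Fin 2} {u : List (Fin 2)}
    (hu : IsRightSpecial k (a :: Kimberling.lift u)) (hlen : 1 ≤ u.length) :
    IsRightSpecial k ((1 - a) :: u) := by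
  have hl : 4 ≤ (a :: Kimberling.lift u).length := by
    have := length_hWord u
    simp only [List.length_cons, Kimberling.lift, List.length_append, List.length_nil]
    omega
  obtain ⟨v, hv, hav, -⟩ := hu.exists_lift (hu.zero_mem hl)
  have huv : u <:+ v := suffix_of_lift_suffix ((List.suffix_cons _ _).trans hav)
  obtain ⟨t, rfl⟩ := huv
  rcases List.eq_nil_or_concat' t with rfl | ⟨t, b, rfl⟩
  · have := hav.length_le
    simp at this
  · have hb : b :: u <:+ t ++ [b] ++ u := ⟨t, by simp⟩
    have h1 := (cons_lift_suffix b u).trans (lift_suffix hb)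
    have e : a :: Kimberling.lift u = (1 - b) :: Kimberling.lift u :=
      List.IsSuffix.eq_of_length (List.suffix_of_suffix_length_le hav h1 (by simp)) (by simp)
    obtain rfl : a = 1 - b := by simpa using e
    rw [sub_sub_cancel]
    exact hv.suffix hb

theorem three_le_length_leaf (i : ℕ) : 3 ≤ (leaf i).length := by
  induction i with
  | zero => simp [leaf]
  | succ i ih =>
    rw [leaf_succ]
    exact ih.trans (length_lt_length_lift _).le

theorem isRightSpecial_zero_one_one : IsRightSpecial k [0, 1, 1] :=
  isRightSpecial_one_zero_one_one.suffix ⟨[1], rfl⟩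

theorem isRightSpecial_cons_branch (i : ℕ) (a : Fin 2) : IsRightSpecial k (a :: branch i) := by
  induction i generalizing a with
  | zero =>
    match a with
    | 0 => exact isRightSpecial_zero_one_one
    | 1 => exact isRightSpecial_ones
  | succ i ih =>
    rw [branch_succ]
    simpa using (ih (1 - a)).cons_lift

theorem isRightSpecial_branch (i : ℕ) : IsRightSpecial k (branch i) :=
  (isRightSpecial_cons_branch i 0).suffix (List.suffix_cons _ _)

theorem isRightSpecial_leaf (i : ℕ) : IsRightSpecial k (leaf i) := by
  induction i with
  | zero => exact isRightSpecial_ones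
  | succ i ih => rw [leaf_succ]; exact ih.lift

theorem not_isRightSpecial_cons_leaf (i : ℕ) (a : Fin 2) : ¬ IsRightSpecial k (a :: leaf i) := by
  induction i generalizing a with
  | zero => exact not_isRightSpecial_cons_ones a
  | succ i ih =>
    rw [leaf_succ]
    exact fun ha => ih _ (ha.of_cons_lift (by have := three_le_length_leaf i; omega))

/-- Induction on length through the minimal preimage `v`. If `w = lift v`, the children of `w`
correspond to those of `v`; if `w` is a proper suffix of `lift v`, the letter before it is already
determined. -/
theorem existsUnique_cons_isRightSpecial {w : List (Fin 2)} (hw : IsRightSpecial k w)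
    (hbranch : ∀ i, w ≠ branch i) (hleaf : ∀ i, w ≠ leaf i) :
    ∃! a, IsRightSpecial k (a :: w) := by
  rcases lt_or_ge w.length 4 with hlen | hlen
  · have hmem := isRightSpecial_of_length_lt_four hw hlen
    have unique : ∀ {u : List (Fin 2)}, IsRightSpecial k (1 :: u) →
        [0] ++ u ∉ [[], [1], [1, 1], [0, 1, 1], [1, 1, 1]] → (0 :: u).length < 4 →
        ∃! a, IsRightSpecial k (a :: u) := by
      intro u h1 h2 h3
      refine ⟨1, h1, fun a ha => ?_⟩
      match a, ha with
      | 0, ha => exact absurd (isRightSpecial_of_length_lt_four ha h3) h2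
      | 1, _ => rfl
    simp only [List.mem_cons, List.not_mem_nil, or_false] at hmem
    rcases hmem with rfl | rfl | rfl | rfl | rfl
    · exact unique (isRightSpecial_ones.suffix ⟨[1, 1], rfl⟩) (by decide) (by simp)
    · exact unique (isRightSpecial_ones.suffix ⟨[1], rfl⟩) (by decide) (by simp)
    · exact absurd rfl (hbranch 0)
    · refine ⟨1, isRightSpecial_one_zero_one_one, fun a ha => ?_⟩
      match a, ha with
      | 0, ha => exact absurd (ha.1.infix ⟨[], [1, 1, 0], rfl⟩) not_isFactor_zero_zero
      | 1, _ => rfl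
    · exact absurd rfl (hleaf 0)
  · obtain ⟨v, hv, ⟨t, ht⟩, hmin⟩ := hw.exists_lift (hw.zero_mem hlen)
    rcases List.eq_nil_or_concat' t with rfl | ⟨t, a, rfl⟩
    · obtain rfl : w = lift v := ht
      have hv1 : 1 ≤ v.length := by
        rw [Nat.one_le_iff_ne_zero, ne_eq, List.length_eq_zero_iff]
        rintro rfl
        simp [lift, hWord_nil] at hlen
      obtain ⟨a, ha, hunique⟩ := existsUnique_cons_isRightSpecial hv
        (fun i e => hbranch (i + 1) (by rw [e, branch_succ]))
        (fun i e => hleaf (i + 1) (by rw [e, leaf_succ]))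
      refine ⟨1 - a, ha.cons_lift, fun b hb => ?_⟩
      rw [← hunique _ (hb.of_cons_lift hv1), sub_sub_cancel]
    · have haw : a :: w <:+ lift v := ⟨t, by rw [← ht]; simp⟩
      refine ⟨a, hv.lift.suffix haw, fun b hb => ?_⟩
      obtain ⟨v', -, hbv, -⟩ := hb.exists_lift (hb.zero_mem (by simp; omega))
      -- By minimality `lift v'` ends in `lift v`, so the letter before `w` is the same in both.
      have hvv : v <:+ v' := hmin v' ((List.suffix_cons _ _).trans hbv)
      have e : b :: w = a :: w := List.IsSuffix.eq_of_length
        (List.suffix_of_suffix_length_le hbv (haw.trans (lift_suffix hvv)) (by simp)) (by simp)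
      simpa using e
termination_by w.length
decreasing_by
  have := length_lt_length_lift v
  simp_all

/-! ### Lengths of branchings and leaves -/

/-- Applying h^(n+1) to 110 gives K_{n+2} = K_{n+1}K_{n+1}K_nK_n, because h(0) = 11. -/
theorem calK_succ_succ (n : ℕ) : calK (n + 2) = 2 * calK (n + 1) + 2 * calK n := by
  have iter_append : ∀ (m : ℕ) (u v : List (Fin 2)),
      hWord^[m] (u ++ v) = hWord^[m] u ++ hWord^[m] v := by
    intro m
    induction m with
    | zero => simp
    | succ m ih => intro u v; simp [hWord_append, ih]
  have e1 : K (n + 2) = K (n + 1) ++ K (n + 1) ++ (K n ++ K n) := by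
    have e0 : hWord^[n + 1] [0] = K n ++ K n := by
      rw [Function.iterate_succ_apply]
      exact iter_append n [1] [1]
    have e : K (n + 2) = hWord^[n + 1] ([1] ++ [1] ++ [0]) := Function.iterate_succ_apply _ _ _
    rw [e, iter_append, iter_append, e0]
    rfl
  simp only [calK, e1, List.length_append]
  ring

theorem calK_le_succ (n : ℕ) : calK n ≤ calK (n + 1) := (K_prefix_succ n).length_le

theorem branch_succ_eq (i : ℕ) : branch (i + 1) = K (i + 1) ++ K (i + 1) ++ branch i := by
  induction i with
  | zero => decide
  | succ i ih =>
    rw [branch_succ (i + 1)]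
    nth_rw 1 [ih]
    rw [lift_append, hWord_append, ← K_succ, ← branch_succ]

theorem leaf_eq (i : ℕ) : leaf i = K i ++ branch i := by
  induction i with
  | zero => decide
  | succ i ih => rw [leaf_succ, ih, lift_append, ← K_succ, ← branch_succ]

theorem length_branch_succ (i : ℕ) :
    (branch (i + 1)).length = 2 * calK (i + 1) + (branch i).length := by
  simp only [branch_succ_eq, calK, List.length_append]
  ring

theorem length_branch_succ_succ (i : ℕ) :
    (branch (i + 2)).length = calK (i + 3) + (branch i).length := by
  rw [length_branch_succ, length_branch_succ, calK_succ_succ (i + 1)]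
  ring

theorem length_leaf (i : ℕ) : (leaf i).length = (branch i).length + calK i := by
  simp only [leaf_eq, calK, List.length_append]
  ring

theorem length_branch_lt_leaf (i : ℕ) : (branch i).length < (leaf i).length := by
  have := lt_calK i
  rw [length_leaf]
  omega

theorem length_leaf_lt_branch_succ (i : ℕ) : (leaf i).length < (branch (i + 1)).length := by
  have := calK_le_succ i
  have := lt_calK (i + 1)
  rw [length_leaf, length_branch_succ]
  omega

theorem strictMono_length_branch : StrictMono fun i => (branch i).length :=
  strictMono_nat_of_lt_succ fun i =>
    (length_branch_lt_leaf i).trans (length_leaf_lt_branch_succ i)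

/-- The sum telescopes by `length_branch_succ_succ`; the extra 1 marks the first length after the
branching. -/
theorem sum_calK_odd (i : ℕ) :
    ∑ j ∈ Finset.range (i + 1), calK (2 * j + 1) = (branch (2 * i)).length + 1 := by
  induction i with
  | zero => decide
  | succ i ih =>
    rw [Finset.sum_range_succ, ih, show 2 * (i + 1) = 2 * i + 2 by ring, length_branch_succ_succ]
    ring

theorem sum_calK_even (i : ℕ) :
    ∑ j ∈ Finset.range (i + 2), calK (2 * j) = (branch (2 * i + 1)).length + 1 := by
  induction i with
  | zero => decide
  | succ i ih =>
    rw [Finset.sum_range_succ, ih, show 2 * (i + 1) + 1 = 2 * i + 1 + 2 by ring,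
      length_branch_succ_succ, show 2 * (i + 2) = 2 * i + 1 + 3 by ring]
    ring

/-! ### Counting by length -/

theorem mem_rightSpecial {x : ℕ → Fin 2} {n : ℕ} {w : List (Fin 2)} :
    w ∈ rightSpecial x n ↔ w.length = n ∧ IsRightSpecial x w := Iff.rfl

theorem mem_rightSpecial_succ {n : ℕ} {w : List (Fin 2)} :
    w ∈ rightSpecial k (n + 1) ↔
      ∃ u ∈ rightSpecial k n, ∃ a, IsRightSpecial k (a :: u) ∧ w = a :: u := by
  constructor
  · rintro ⟨hlen, hw⟩
    match w, hlen with
    | a :: u, hlen =>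
      exact ⟨u, ⟨by simpa using hlen, hw.suffix (List.suffix_cons a u)⟩, a, hw, rfl⟩
  · rintro ⟨u, ⟨hlen, -⟩, a, ha, rfl⟩
    exact ⟨by simp [hlen], ha⟩

/-- The right-special factors of length `n`: there are two of them between the lengths of a
branching factor and of the corresponding leaf, and one otherwise. -/
theorem rightSpecial_eq (n : ℕ) :
    (∃ i, n ≤ (branch i).length ∧ (∀ j < i, (leaf j).length < n) ∧
      ∃ w, rightSpecial k n = {w}) ∨
    (∃ i, (branch i).length < n ∧ n ≤ (leaf i).length ∧
      ∃ w w', w ≠ w' ∧ rightSpecial k n = {w, w'}) := by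
  have mono := strictMono_length_branch
  induction n with
  | zero =>
    refine Or.inl ⟨0, Nat.zero_le _, by simp, [], ?_⟩
    ext w
    simp only [mem_rightSpecial, List.length_eq_zero_iff, Set.mem_singleton_iff,
      and_iff_left_iff_imp]
    rintro rfl
    exact isRightSpecial_ones.suffix List.nil_suffix
  | succ n ih =>
    rcases ih with ⟨i, hn, hleaf, w, hw⟩ | ⟨i, hn, hleaf, w, w', hne, hw⟩
    · have hmem : w ∈ rightSpecial k n := by simp [hw]
      rcases hn.eq_or_lt with rfl | hlt
      · right
        refine ⟨i, Nat.lt_succ_self _, length_branch_lt_leaf i, 0 :: branch i, 1 :: branch i,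
          by simp, ?_⟩
        have hb : branch i ∈ rightSpecial k (branch i).length := ⟨rfl, isRightSpecial_branch i⟩
        obtain rfl : branch i = w := by simpa [hw] using hb
        ext u
        simp only [mem_rightSpecial_succ, hw, Set.mem_singleton_iff, exists_eq_left,
          isRightSpecial_cons_branch, true_and, Set.mem_insert_iff, Fin.exists_fin_two]
      · left
        refine ⟨i, hlt, fun j hj => (hleaf j hj).trans (Nat.lt_succ_self n), ?_⟩
        -- Here n exceeds all earlier leaf lengths and is below |`branch i`|, so `w` is neither a
        -- branching nor a leaf.
        obtain ⟨a, ha, hunique⟩ := existsUnique_cons_isRightSpecial hmem.2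
          (fun j e => by
            have hj := hmem.1
            rw [e] at hj
            rcases lt_or_ge j i with hji | hji
            · have := hleaf j hji
              have := length_branch_lt_leaf j
              omega
            · have := mono.monotone hji
              omega)
          (fun j e => by
            have hj := hmem.1
            rw [e] at hj
            rcases lt_or_ge j i with hji | hji
            · have := hleaf j hji
              omega
            · have := mono.monotone hji
              have := length_branch_lt_leaf j
              omega)
        refine ⟨a :: w, ?_⟩
        ext u
        simp only [mem_rightSpecial_succ, hw, Set.mem_singleton_iff, exists_eq_left]
        exact ⟨fun ⟨b, hb, e⟩ => by rw [e, hunique b hb], fun e => ⟨a, ha, e⟩⟩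
    · have ext_of : ∀ u ∈ rightSpecial k n, u ≠ leaf i → ∃! a, IsRightSpecial k (a :: u) := by
        intro u hu hul
        apply existsUnique_cons_isRightSpecial hu.2
        · rintro j rfl
          have hj := hu.1
          rcases lt_or_ge i j with hij | hij
          · have := mono.monotone (Nat.succ_le_of_lt hij)
            have := length_leaf_lt_branch_succ i
            simp only [Nat.succ_eq_add_one] at *
            omega
          · have := mono.monotone hij
            omega
        · rintro j rfl
          have hj := hu.1
          rcases lt_trichotomy i j with hij | rfl | hij
          · have := mono.monotone (Nat.succ_le_of_lt hij)
            have := length_leaf_lt_branch_succ i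
            have := length_branch_lt_leaf j
            simp only [Nat.succ_eq_add_one] at *
            omega
          · exact hul rfl
          · have := mono.monotone (Nat.succ_le_of_lt hij)
            have := length_leaf_lt_branch_succ j
            simp only [Nat.succ_eq_add_one] at *
            omega
      -- At length |`leaf i`| one of the two factors is the leaf and dies; below it both extend
      -- uniquely.
      rcases hleaf.eq_or_lt with rfl | hlt
      · left
        refine ⟨i + 1, length_leaf_lt_branch_succ i, fun j hj => ?_, ?_⟩
        · rcases (Nat.lt_succ_iff.1 hj).eq_or_lt with rfl | hji
          · exact Nat.lt_succ_self _
          · have := mono.monotone (Nat.succ_le_of_lt hji)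
            have := length_leaf_lt_branch_succ j
            simp only [Nat.succ_eq_add_one] at *
            omega
        · obtain ⟨v, hvl, hv⟩ : ∃ v, v ≠ leaf i ∧
              rightSpecial k (leaf i).length = {leaf i, v} := by
            have hl : leaf i ∈ rightSpecial k (leaf i).length := ⟨rfl, isRightSpecial_leaf i⟩
            rw [hw] at hl ⊢
            rcases hl with hl | hl
            · exact ⟨w', fun e => hne (by rw [e, hl]), by rw [hl]⟩
            · obtain rfl : leaf i = w' := hl
              exact ⟨w, hne, Set.pair_comm _ _⟩
          obtain ⟨a, ha, hunique⟩ := ext_of v (by simp [hv]) hvl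
          refine ⟨a :: v, ?_⟩
          ext u
          simp only [mem_rightSpecial_succ, hv, Set.mem_insert_iff, Set.mem_singleton_iff,
            exists_eq_or_imp, exists_eq_left, not_isRightSpecial_cons_leaf, false_and,
            exists_false, false_or]
          exact ⟨fun ⟨b, hb, e⟩ => by rw [e, hunique b hb], fun e => ⟨a, ha, e⟩⟩
      · right
        refine ⟨i, hn.trans (Nat.lt_succ_self n), hlt, ?_⟩
        have hlen : ∀ u ∈ rightSpecial k n, u ≠ leaf i := by
          rintro u hu rfl
          exact hlt.ne' hu.1
        have hwm : w ∈ rightSpecial k n := by simp [hw]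
        have hwm' : w' ∈ rightSpecial k n := by simp [hw]
        obtain ⟨a, ha, hunique⟩ := ext_of w hwm (hlen w hwm)
        obtain ⟨a', ha', hunique'⟩ := ext_of w' hwm' (hlen w' hwm')
        refine ⟨a :: w, a' :: w', by simp [hne], ?_⟩
        ext u
        simp only [mem_rightSpecial_succ, hw, Set.mem_insert_iff, Set.mem_singleton_iff,
          exists_eq_or_imp, exists_eq_left]
        exact or_congr
          ⟨fun ⟨b, hb, e⟩ => by rw [e, hunique b hb], fun e => ⟨a, ha, e⟩⟩
          ⟨fun ⟨b, hb, e⟩ => by rw [e, hunique' b hb], fun e => ⟨a', ha', e⟩⟩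

theorem encard_rightSpecial_le (n : ℕ) : (rightSpecial k n).encard ≤ 2 := by
  rcases rightSpecial_eq n with ⟨-, -, -, w, hw⟩ | ⟨-, -, -, w, w', hne, hw⟩
  · simp [hw]
  · rw [hw, Set.encard_pair hne]

theorem encard_rightSpecial_eq_two_iff (n : ℕ) : (rightSpecial k n).encard = 2 ↔
    ∃ i, (branch i).length + 1 ≤ n ∧ n < (branch i).length + 1 + calK i := by
  rcases rightSpecial_eq n with ⟨i, hn, hleaf, w, hw⟩ | ⟨i, hn, hleaf, w, w', hne, hw⟩
  · refine iff_of_false (by simp [hw]) ?_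
    rintro ⟨j, h1, h2⟩
    rcases lt_or_ge j i with hji | hji
    · have := hleaf j hji
      rw [length_leaf] at this
      omega
    · have := strictMono_length_branch.monotone hji
      omega
  · rw [length_leaf] at hleaf
    exact iff_of_true (by rw [hw, Set.encard_pair hne]) ⟨i, hn, by omega⟩

end Kimberling

theorem theorem9 :
    (∀ n : ℕ, (Kimberling.rightSpecial Kimberling.k n).encard ≤ 2) ∧
    (∀ n : ℕ, (Kimberling.rightSpecial Kimberling.k n).encard = 2 ↔
      ∃ i : ℕ,
        ((∑ j ∈ Finset.range (i + 1), Kimberling.calK (2 * j + 1)) ≤ n ∧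
          n < (∑ j ∈ Finset.range (i + 1), Kimberling.calK (2 * j + 1)) +
            Kimberling.calK (2 * i)) ∨
        ((∑ j ∈ Finset.range (i + 2), Kimberling.calK (2 * j)) ≤ n ∧
          n < (∑ j ∈ Finset.range (i + 2), Kimberling.calK (2 * j)) +
            Kimberling.calK (2 * i + 1))) := by
  refine ⟨Kimberling.encard_rightSpecial_le, fun n => ?_⟩
  rw [Kimberling.encard_rightSpecial_eq_two_iff]
  simp only [Kimberling.sum_calK_odd, Kimberling.sum_calK_even]
  constructor
  · rintro ⟨i, hi⟩
    -- The parity of the branching index selects the family of intervals.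
    rcases Nat.even_or_odd' i with ⟨j, rfl | rfl⟩
    · exact ⟨j, Or.inl hi⟩
    · exact ⟨j, Or.inr hi⟩
  · rintro ⟨i, hi | hi⟩
    · exact ⟨2 * i, hi⟩
    · exact ⟨2 * i + 1, hi⟩
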